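/- Let $\xi$ be a probability measure on $\{0,1,2,\dots\}$ and, for each $k\ge 1$, let $\eta^{(k)}$ be a probability measure on $\{-1,0,1\}^k$. Let $T$ be the labelled Galton--Watson tree whose root has label $0$, with offspring distribution $\xi$ and displacement laws $\eta^{(k)}$: a finite rooted plane tree $t$, with integer labels changing by $-1$, $0$ or $1$ along each edge and root label $0$, has probability $$\Pi_0(t)=\prod_{v\in V(t)}\xi(k_t(v))\,\eta^{(k_t(v))}([v]_t),$$ where $k_t(v)$ is the number of children of $v$, $[v]_t$ is the vector of label increments from $v$ to its children listed from left to right, and $\eta^{(0)}(\varnothing)=1$. For $l\in\{-1,1\}$ consider the number of vertices of $T$ that have label $l$ and no strict ancestor with label $l$. Let $\nu_-$ be its law for $l=1$, and $\nu_+$ its law for $l=-1$. For a probability measure $\nu$ on $\{0,1,2,\dots\}$ write $g_\nu(z)=\sum_{k\ge0}\nu(k)z^k$ for $z\in[0,1]$. In each of the following four cases $\nu_+$ and $\nu_-$ are probability measures and $\nu_+=\nu_-=:\nu$, and $g_\nu(z)$ is given for every $z\in[0,1]$ by the stated formula; in cases 1 and 2 the right-hand side at $z=0$ is understood as its limit as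 $z\downarrow 0$, which is $5/8$ in case 1 and $2/3$ in case 2. 1. If $\xi(k)=2^{-k-1}$ for all $k\ge0$ and $\eta^{(k)}=\mathcal U(\{-1,1\})^{\otimes k}$ for all $k\ge1$, then $$g_\nu(z)=\frac{-2z^2+9z-4+2\sqrt{4-z}\,(1-z)^{3/2}}{z(4-z)}.$$ 2. If $\xi(k)=2^{-k-1}$ for all $k\ge0$ and $\eta^{(k)}=\mathcal U(\{-1,0,1\})^{\otimes k}$ for all $k\ge1$, then $$g_\nu(z)=\frac{-z^2+6z-3+\sqrt{9-z}\,(1-z)^{3/2}}{2z}.$$ 3. (Incomplete binary trees.) If $\xi=\frac14\delta_0+\frac12\delta_1+\frac14\delta_2$, $\eta^{(1)}=\frac12(\delta_{-1}+\delta_1)$ and $\eta^{(2)}=\delta_{(-1,1)}$, then $$g_\nu(z)=\frac{-z^2+16z-3+\sqrt{49-z}\,(1-z)^{3/2}}{2(z+5)}.$$ 4. (Complete binary trees.) If $\xi=\frac12(\delta_0+\delta_2)$ and $\eta^{(2)}=\delta_{(-1,1)}$, then $$g_\nu(z)=\frac{-z^2+10z-3+\sqrt{25-z}\,(1-z)^{3/2}}{2(z+2)}.$$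 -/

import Mathlib

open scoped ENNReal Topology

noncomputable section

/-- `LTree x` is the set of finite labelled rooted plane trees whose root carries the label `x : ℤ`
and whose labels change by `-1`, `0` or `1` along each edge: the root has `k ≥ 0` ordered children,
the `i`-th edge out of the root carries the displacement `s i ∈ {-1, 0, 1}`, and the `i`-th child is
the root of a labelled plane tree with root label `x + s i`. -/
inductive LTree : ℤ → Type
  | node (x : ℤ) (k : ℕ) (s : Fin k → SignType) (c : (i : Fin k) → LTree (x + (s i : ℤ))) : LTree x

namespace LTree

/-- The weight `Π(t) = ∏_{v ∈ V(t)} ξ(k_t(v)) η^{(k_t(v))}([v]_t)` of a labelled plane tree, where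
`k_t(v)` is the number of children of `v` and `[v]_t` is the vector of label displacements from `v`
to its children. On `LTree x` this is the mass function of the law of the labelled Galton--Watson
tree rooted at `x`. For `k = 0` the law `η 0` is the unit mass at the empty vector. -/
def weight (ξ : PMF ℕ) (η : (k : ℕ) → PMF (Fin k → SignType)) : {x : ℤ} → LTree x → ℝ≥0∞
  | _, node _ k s c => ξ k * η k s * ∏ i, weight ξ η (c i)

/-- Truncation at level `l`: delete all vertices having a strict ancestor with label `l`. -/
def trunc (l : ℤ) : {x : ℤ} → LTree x → LTree x
  | _, node x k s c =>
    if x = l then node x 0 Fin.elim0 (fun i => i.elim0)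
    else node x k s (fun i => trunc l (c i))

/-- The number of leaves with label `l`. -/
def leaves (l : ℤ) : {x : ℤ} → LTree x → ℕ
  | _, node x k _ c => if k = 0 then (if x = l then 1 else 0) else ∑ i, leaves l (c i)

/-- The number of leaves with label `l` in the truncation at level `l`, that is, the number of
vertices with label `l` that have no strict ancestor with label `l`. -/
def hits (l : ℤ) {x : ℤ} (t : LTree x) : ℕ := leaves l (trunc l t)

end LTree

/-- The law of `hits l T` for a labelled Galton--Watson tree `T` rooted at `0`. -/
def hitLaw (ξ : PMF ℕ) (η : (k : ℕ) → PMF (Fin k → SignType)) (l : ℤ) (n : ℕ) : ℝ≥0∞ :=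
  ∑' t : {t : LTree 0 // LTree.hits l t = n}, LTree.weight ξ η t.1

/-- `ν_-`: the law of the number of first hitting points of level `1`. -/
def nuMinus (ξ : PMF ℕ) (η : (k : ℕ) → PMF (Fin k → SignType)) : ℕ → ℝ≥0∞ := hitLaw ξ η 1

/-- `ν_+`: the law of the number of first hitting points of level `-1`. -/
def nuPlus (ξ : PMF ℕ) (η : (k : ℕ) → PMF (Fin k → SignType)) : ℕ → ℝ≥0∞ := hitLaw ξ η (-1)

/-- The generating function `g_ν(z) = ∑_k ν(k) z^k` (used for probability distributions `ν` on `ℕ`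
and `z ∈ [0, 1]`, where the series converges). -/
def genFun (ν : ℕ → ℝ≥0∞) (z : ℝ) : ℝ := ∑' k, (ν k).toReal * z ^ k

/-- The critical geometric distribution `ξ(k) = 2^{-k-1}`. -/
def critGeometric : PMF ℕ :=
  ⟨fun k => (2⁻¹ : ℝ≥0∞) ^ (k + 1), by
    rw [← ENNReal.tsum_two_zpow_neg_add_one]
    convert ENNReal.summable.hasSum using 3 with k
    rw [show (-1 - (k : ℤ)) = -((k + 1 : ℕ) : ℤ) by push_cast; ring, ENNReal.zpow_neg, zpow_natCast,
      ENNReal.inv_pow]⟩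

/-- The distribution `(1/4) δ_0 + (1/2) δ_1 + (1/4) δ_2`. -/
def incompleteBinary : PMF ℕ :=
  PMF.ofFinset (fun k => if k = 0 then 4⁻¹ else if k = 1 then 2⁻¹ else if k = 2 then 4⁻¹ else 0)
    {0, 1, 2} (by
      have h : (4⁻¹ : ℝ≥0∞) = 2⁻¹ * 2⁻¹ := by
        rw [← ENNReal.mul_inv (by simp) (by simp)]; norm_num
      simp only [Finset.sum_insert, Finset.mem_insert, Finset.mem_singleton, Finset.sum_singleton,
        h, zero_ne_one, OfNat.zero_ne_ofNat, OfNat.one_ne_ofNat, or_self, not_false_eq_true,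
        if_true, if_false, one_ne_zero, OfNat.ofNat_ne_zero, OfNat.ofNat_ne_one]
      rw [add_comm (2⁻¹ : ℝ≥0∞), ← add_assoc, ← mul_add, ENNReal.inv_two_add_inv_two, mul_one,
        ENNReal.inv_two_add_inv_two])
    (by intro a ha; simp only [Finset.mem_insert, Finset.mem_singleton, not_or] at ha; simp [ha])

/-- The distribution `(1/2) (δ_0 + δ_2)`. -/
def completeBinary : PMF ℕ := PMF.uniformOfFinset {0, 2} (by simp)

/-- The product law `u^{⊗ k}` on `{-1, 0, 1}^k`. -/
def iidSteps (u : PMF SignType) (k : ℕ) : PMF (Fin k → SignType) :=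
  PMF.ofFintype (fun s => ∏ i, u (s i)) (by
    have h : ∑ a, u a = 1 := by rw [← u.tsum_coe, tsum_fintype]
    simpa [h] using Finset.sum_prod_piFinset (ι := Fin k) Finset.univ (fun _ a => u a))

end

/-!
Write `w` for one minus the generating function of the number of first hits of level `l`, as a
function of the label at the root. Conditioning on the children of the root gives, in each of the
four cases, the second order recursion `a - 2 b + c = α b (a + c) + β b² + γ a c` for the values
`a, b, c` of `w` at three consecutive labels. The right-hand side is nonnegative, so `w` is convex
along the half-line starting at `l`; being bounded, it decreases, and it decreases to a zero of the
right-hand side, which is `0`. The four recursions moreover have a first integral: a polynomial `E`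
with `E (0, 0) = 0` and `(1 - γ c) E (a, b) = (1 - γ a) E (b, c)`. Since `c ≤ a`, the absolute value
of `E` at consecutive pairs does not decrease along the half-line; as it tends to `0`, it vanishes.
Hence `E (w l, w 0) = 0`, a quadratic equation for `w 0` in terms of `w l = 1 - z`, and `w 0 ≤ w l`
selects the root. Applied to the probability that `T` is infinite, the recursion makes it monotone
along both half-lines, so it is constant, and a constant solution vanishes.
-/

section BoundedRecursions

theorem antitone_of_le_midpoint {w : ℕ → ℝ} (hbdd : BddAbove (Set.range w))
    (hconv : ∀ n, 2 * w (n + 1) ≤ w n + w (n + 2)) : Antitone w := by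
  have hincr : Monotone fun n => w (n + 1) - w n :=
    monotone_nat_of_le_succ fun n => by linarith [hconv n]
  refine antitone_nat_of_succ_le fun m => ?_
  by_contra! hm
  obtain ⟨C, hC⟩ := hbdd
  obtain ⟨k, hk⟩ := Archimedean.arch (C - w m + 1) (sub_pos.2 hm)
  have hsum : k • (w (m + 1) - w m) ≤ w (m + k) - w m := by
    calc k • (w (m + 1) - w m)
        ≤ ∑ i ∈ Finset.range k, (w (m + i + 1) - w (m + i)) := by
          simpa using Finset.card_nsmul_le_sum (Finset.range k)
            (fun i => w (m + i + 1) - w (m + i)) _ fun i _ => hincr (m.le_add_right i)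
      _ = w (m + k) - w m := Finset.sum_range_sub (fun i => w (m + i)) k
  linarith [hC (Set.mem_range_self (m + k))]

/-- The quadratic form that gives the second difference `a - 2 b + c` of the deficits at three
consecutive labels. -/
def curvature (α β γ a b c : ℝ) : ℝ := α * (b * (a + c)) + β * b ^ 2 + γ * (a * c)

/-- A `[0, 1]`-valued solution on the half-line `ℕ` of the recursion with the given curvature. -/
structure IsSolution (α β γ : ℝ) (w : ℕ → ℝ) : Prop where
  mem_Icc : ∀ n, w n ∈ Set.Icc 0 1
  recursion : ∀ n, w n - 2 * w (n + 1) + w (n + 2) = curvature α β γ (w n) (w (n + 1)) (w (n + 2))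

/-- The first integral of the recursion, where `θ` is the value of the curvature at `(1, 1, 1)`. For
`κ = 0` it discretizes the first integral `2 θ w³ - 3 w'²` of `w'' = θ w²`. -/
def energy (θ κ p q : ℝ) : ℝ := θ * (p * q * (p + q)) + κ * (p * q) ^ 2 - 3 * (p - q) ^ 2

/-- The curvature with coefficients `α, β, γ` is nonnegative and definite on `[0, 1]`, and
`energy θ κ` is a first integral of the corresponding recursion up to the factors `1 - γ a` and
`1 - γ c`. -/
structure IsIntegrable (α β γ θ κ : ℝ) : Prop where
  adjacent_nonneg : 0 ≤ α
  center_nonneg : 0 ≤ β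
  outer_nonneg : 0 ≤ γ
  quartic_nonneg : 0 ≤ κ
  outer_le_one : γ ≤ 1
  total : 2 * α + β + γ = θ
  pos : 0 < θ
  conserved : ∀ a b c, a - 2 * b + c = curvature α β γ a b c →
    (1 - γ * c) * energy θ κ a b = (1 - γ * a) * energy θ κ b c

theorem curvature_comm (α β γ a b c : ℝ) : curvature α β γ a b c = curvature α β γ c b a := by
  simp only [curvature]; ring

theorem curvature_self (α β γ b : ℝ) : curvature α β γ b b b = (2 * α + β + γ) * b ^ 2 := by
  simp only [curvature]; ring

variable {α β γ θ κ : ℝ} {w : ℕ → ℝ}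

theorem IsIntegrable.eq_zero_of_curvature_self (h : IsIntegrable α β γ θ κ) {b : ℝ}
    (hb : curvature α β γ b b b = 0) : b = 0 := by
  rw [curvature_self, h.total] at hb
  simpa [h.pos.ne'] using hb

theorem IsIntegrable.antitone (h : IsIntegrable α β γ θ κ) (hw : IsSolution α β γ w) :
    Antitone w := by
  refine antitone_of_le_midpoint ⟨1, Set.forall_mem_range.2 fun n => (hw.mem_Icc n).2⟩ fun n => ?_
  have hα := h.adjacent_nonneg
  have hβ := h.center_nonneg
  have hγ := h.outer_nonneg
  have ha := (hw.mem_Icc n).1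
  have hb := (hw.mem_Icc (n + 1)).1
  have hc := (hw.mem_Icc (n + 2)).1
  have hcurv : 0 ≤ curvature α β γ (w n) (w (n + 1)) (w (n + 2)) := by
    unfold curvature; positivity
  linarith [hw.recursion n]

theorem IsIntegrable.tendsto_zero (h : IsIntegrable α β γ θ κ) (hw : IsSolution α β γ w) :
    Filter.Tendsto w Filter.atTop (𝓝 0) := by
  have hlim := tendsto_atTop_ciInf (h.antitone hw)
    ⟨0, Set.forall_mem_range.2 fun n => (hw.mem_Icc n).1⟩
  set L := ⨅ n, w n
  have hlim₁ := (Filter.tendsto_add_atTop_iff_nat 1).2 hlim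
  have hlim₂ := (Filter.tendsto_add_atTop_iff_nat 2).2 hlim
  have hcurv : Filter.Tendsto (fun n => curvature α β γ (w n) (w (n + 1)) (w (n + 2)))
      Filter.atTop (𝓝 (curvature α β γ L L L)) :=
    (((hlim₁.mul (hlim.add hlim₂)).const_mul α).add ((hlim₁.pow 2).const_mul β)).add
      ((hlim.mul hlim₂).const_mul γ)
  have hdiff : Filter.Tendsto (fun n => w n - 2 * w (n + 1) + w (n + 2)) Filter.atTop (𝓝 0) := by
    convert (hlim.sub (hlim₁.const_mul 2)).add hlim₂ using 2
    ring
  rw [funext hw.recursion] at hdiff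
  rwa [h.eq_zero_of_curvature_self (tendsto_nhds_unique hcurv hdiff)] at hlim

theorem IsIntegrable.lt_one (h : IsIntegrable α β γ θ κ) (hw : IsSolution α β γ w) (n : ℕ) :
    w (n + 2) < 1 := by
  refine (hw.mem_Icc _).2.lt_of_ne fun hc => ?_
  have hb : w (n + 1) = 1 :=
    (hw.mem_Icc _).2.antisymm (hc.ge.trans (h.antitone hw (Nat.le_succ _)))
  have ha : w n = 1 := (hw.mem_Icc _).2.antisymm (hb.ge.trans (h.antitone hw (Nat.le_succ _)))
  have hcurv := hw.recursion n
  rw [ha, hb, hc] at hcurv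
  exact one_ne_zero (h.eq_zero_of_curvature_self (hcurv.symm.trans (by norm_num)))

theorem IsIntegrable.abs_energy_le (h : IsIntegrable α β γ θ κ) (hw : IsSolution α β γ w) (n : ℕ) :
    |energy θ κ (w n) (w (n + 1))| ≤ |energy θ κ (w (n + 1)) (w (n + 2))| := by
  have hγ := h.outer_nonneg
  have hca : w (n + 2) ≤ w n := h.antitone hw (Nat.le_add_right n 2)
  have hγa : γ * w n ≤ 1 := mul_le_one₀ h.outer_le_one (hw.mem_Icc n).1 (hw.mem_Icc n).2
  have hγc : 0 < 1 - γ * w (n + 2) := sub_pos.2 <|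
    (mul_le_of_le_one_left (hw.mem_Icc _).1 h.outer_le_one).trans_lt (h.lt_one hw n)
  refine le_of_mul_le_mul_left ?_ hγc
  calc (1 - γ * w (n + 2)) * |energy θ κ (w n) (w (n + 1))|
      = (1 - γ * w n) * |energy θ κ (w (n + 1)) (w (n + 2))| := by
        rw [← abs_of_pos hγc, ← abs_mul, h.conserved _ _ _ (hw.recursion n), abs_mul,
          abs_of_nonneg (sub_nonneg.2 hγa)]
    _ ≤ (1 - γ * w (n + 2)) * |energy θ κ (w (n + 1)) (w (n + 2))| := by gcongr

theorem IsIntegrable.energy_eq_zero (h : IsIntegrable α β γ θ κ) (hw : IsSolution α β γ w) :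
    energy θ κ (w 0) (w 1) = 0 := by
  have hmono : Monotone fun n => |energy θ κ (w n) (w (n + 1))| :=
    monotone_nat_of_le_succ (h.abs_energy_le hw)
  have hlim : Filter.Tendsto (fun n => |energy θ κ (w n) (w (n + 1))|) Filter.atTop (𝓝 0) := by
    have hw₀ := h.tendsto_zero hw
    have hw₁ := (Filter.tendsto_add_atTop_iff_nat 1).2 hw₀
    have hcont : Continuous fun x : ℝ × ℝ => |energy θ κ x.1 x.2| := by
      unfold energy; fun_prop
    simpa [Function.comp_def, energy] using (hcont.tendsto (0, 0)).comp (hw₀.prodMk_nhds hw₁)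
  exact abs_nonpos_iff.1 (hmono.ge_of_tendsto hlim 0)

/-- The smaller root `q` of the quadratic equation `energy θ κ p q = 0`, in the rationalized form
that remains valid where the coefficient of `q²` vanishes. -/
noncomputable def energyRoot (θ κ p : ℝ) : ℝ :=
  6 * p / (θ * p + 6 + √(p * ((θ ^ 2 + 12 * κ) * p + 24 * θ)))

theorem eq_energyRoot {p q : ℝ} (hθ : 0 ≤ θ) (hκ : 0 ≤ κ) (hq : 0 ≤ q) (hqp : q ≤ p)
    (hE : energy θ κ p q = 0) : q = energyRoot θ κ p := by
  have hp := hq.trans hqp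
  obtain rfl | hp' := hp.eq_or_lt
  · simpa [energyRoot] using hqp.antisymm hq
  set D := p * ((θ ^ 2 + 12 * κ) * p + 24 * θ) with hD
  have hD0 : 0 ≤ D := by positivity
  have hle : 2 * (3 - θ * p - κ * p ^ 2) * q ≤ θ * p ^ 2 + 6 * p := by
    have : 0 ≤ 2 * (θ * p + κ * p ^ 2) * q := by positivity
    nlinarith [mul_nonneg hθ (sq_nonneg p)]
  have hsqrt : p * √D = θ * p ^ 2 + 6 * p - 2 * (3 - θ * p - κ * p ^ 2) * q := by
    refine (pow_left_inj₀ (by positivity) (sub_nonneg.2 hle) two_ne_zero).1 ?_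
    rw [mul_pow, Real.sq_sqrt hD0, hD]
    unfold energy at hE
    linear_combination 4 * (3 - θ * p - κ * p ^ 2) * hE
  rw [energyRoot, eq_div_iff (by positivity)]
  refine mul_left_cancel₀ hp'.ne' ?_
  unfold energy at hE
  linear_combination q * hsqrt + 2 * hE

theorem IsIntegrable.eq_energyRoot (h : IsIntegrable α β γ θ κ) (hw : IsSolution α β γ w) :
    w 1 = energyRoot θ κ (w 0) :=
  _root_.eq_energyRoot h.pos.le h.quartic_nonneg (hw.mem_Icc 1).1 (h.antitone hw zero_le_one)
    (h.energy_eq_zero hw)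

end BoundedRecursions

section Integrability

theorem isIntegrable_adjacent : IsIntegrable 1 0 0 2 1 where
  adjacent_nonneg := zero_le_one
  center_nonneg := le_rfl
  outer_nonneg := le_rfl
  quartic_nonneg := zero_le_one
  outer_le_one := zero_le_one
  total := by norm_num
  pos := two_pos
  conserved a b c h := by
    simp only [curvature, energy] at h ⊢
    linear_combination (-(a - c) * (b + 3)) * h

theorem isIntegrable_adjacent_add_center : IsIntegrable 1 1 0 3 0 where
  adjacent_nonneg := zero_le_one
  center_nonneg := zero_le_one
  outer_nonneg := le_rfl
  quartic_nonneg := le_rfl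
  outer_le_one := zero_le_one
  total := by norm_num
  pos := three_pos
  conserved a b c h := by
    simp only [curvature, energy] at h ⊢
    linear_combination (-3 * (a - c)) * h

theorem isIntegrable_outer {γ : ℝ} (hγ : 0 < γ) (hγ1 : γ ≤ 1) : IsIntegrable 0 0 γ γ 0 where
  adjacent_nonneg := le_rfl
  center_nonneg := le_rfl
  outer_nonneg := hγ.le
  quartic_nonneg := le_rfl
  outer_le_one := hγ1
  total := by ring
  pos := hγ
  conserved a b c h := by
    simp only [curvature, energy] at h ⊢
    linear_combination (-3 * (a - c) + γ * b * (a - c)) * h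

end Integrability

section PowerSeries

theorem hasFPowerSeriesAt_tsum_of_abs_le {a : ℕ → ℝ} {C : ℝ} (ha : ∀ n, |a n| ≤ C) :
    HasFPowerSeriesAt (fun z => ∑' n, a n * z ^ n) (FormalMultilinearSeries.ofScalars ℝ a) 0 := by
  have hr : (1 : ℝ≥0∞) ≤ (FormalMultilinearSeries.ofScalars ℝ a).radius :=
    FormalMultilinearSeries.le_radius_of_bound (r := 1) _ C fun n => by
      simpa [FormalMultilinearSeries.ofScalars_norm] using ha n
  convert (FormalMultilinearSeries.hasFPowerSeriesOnBall _
    (one_pos.trans_le hr)).hasFPowerSeriesAt using 2 with z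
  simp [FormalMultilinearSeries.sum, mul_comm]

theorem eq_of_tsum_mul_pow_eq {a b : ℕ → ℝ} {C : ℝ} (ha : ∀ n, |a n| ≤ C) (hb : ∀ n, |b n| ≤ C)
    (h : ∀ z : ℝ, 0 < z → z < 1 → ∑' n, a n * z ^ n = ∑' n, b n * z ^ n) : a = b := by
  have hA := hasFPowerSeriesAt_tsum_of_abs_le ha
  have hB := hasFPowerSeriesAt_tsum_of_abs_le hb
  have hright : ∀ᶠ z : ℝ in 𝓝[>] 0, ∑' n, a n * z ^ n = ∑' n, b n * z ^ n := by
    filter_upwards [Ioo_mem_nhdsGT (zero_lt_one' ℝ)] with z hz using h z hz.1 hz.2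
  have hnear : (fun z : ℝ => ∑' n, a n * z ^ n) =ᶠ[𝓝 0] fun z => ∑' n, b n * z ^ n :=
    (AnalyticAt.frequently_eq_iff_eventually_eq hA.analyticAt hB.analyticAt).1 <|
      hright.frequently.filter_mono (nhdsWithin_mono _ fun _ hz => ne_of_gt hz)
  exact FormalMultilinearSeries.ofScalars_series_injective (E := ℝ) ℝ
    ((hA.congr hnear).eq_formalMultilinearSeries hB)

theorem abs_toReal_le_one {p : ℝ≥0∞} (hp : p ≤ 1) : |p.toReal| ≤ 1 := by
  rw [abs_of_nonneg ENNReal.toReal_nonneg]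
  exact ENNReal.toReal_le_of_le_ofReal zero_le_one (by simpa using hp)

theorem eq_of_genFun_eq {μ ν : ℕ → ℝ≥0∞} (hμ : ∀ n, μ n ≤ 1) (hν : ∀ n, ν n ≤ 1)
    (h : ∀ z, 0 < z → z < 1 → genFun μ z = genFun ν z) : μ = ν := by
  have hreal := eq_of_tsum_mul_pow_eq (fun n => abs_toReal_le_one (hμ n))
    (fun n => abs_toReal_le_one (hν n)) h
  funext n
  exact (ENNReal.toReal_eq_toReal_iff' ((hμ n).trans_lt ENNReal.one_lt_top).ne
    ((hν n).trans_lt ENNReal.one_lt_top).ne).1 (congrFun hreal n)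

theorem tendsto_of_genFun_eq {ν : ℕ → ℝ≥0∞} (hν : ∀ n, ν n ≤ 1) {f : ℝ → ℝ}
    (hf : ∀ z, 0 < z → z ≤ 1 → genFun ν z = f z) :
    Filter.Tendsto f (𝓝[>] 0) (𝓝 (genFun ν 0)) := by
  have hcont : ContinuousAt (genFun ν) 0 :=
    (hasFPowerSeriesAt_tsum_of_abs_le fun n => abs_toReal_le_one (hν n)).continuousAt
  refine (hcont.tendsto.mono_left nhdsWithin_le_nhds).congr' ?_
  filter_upwards [Ioc_mem_nhdsGT zero_lt_one] with z hz using hf z hz.1 hz.2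

end PowerSeries

theorem tsum_pi_prod {n : ℕ} {α : Fin n → Type*} (f : (i : Fin n) → α i → ℝ≥0∞) :
    ∑' c : (i : Fin n) → α i, ∏ i, f i (c i) = ∏ i, ∑' a, f i a := by
  induction n with
  | zero => simp
  | succ n ih =>
    calc ∑' c : (i : Fin (n + 1)) → α i, ∏ i, f i (c i)
        = ∑' (a : α 0) (c : (i : Fin n) → α i.succ), f 0 a * ∏ i, f i.succ (c i) := by
          rw [← (Fin.consEquiv α).tsum_eq, ENNReal.tsum_prod']
          simp [Fin.consEquiv, Fin.prod_univ_succ]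
      _ = ∏ i, ∑' a, f i a := by
          simp_rw [ENNReal.tsum_mul_left, ENNReal.tsum_mul_right, ih fun i => f i.succ,
            Fin.prod_univ_succ]

section Offspring

/-- The expectation of `∏ i, f (x + s i)` for a random displacement vector `s` with law `p`. -/
noncomputable def stepMean {k : ℕ} (p : PMF (Fin k → SignType)) (f : ℤ → ℝ≥0∞) (x : ℤ) : ℝ≥0∞ :=
  ∑ s, p s * ∏ i, f (x + (s i : ℤ))

/-- The offspring operator: the expectation of the product of `f` over the labels of the children of
a vertex with label `x`. -/
noncomputable def offspring (ξ : PMF ℕ) (η : (k : ℕ) → PMF (Fin k → SignType)) (f : ℤ → ℝ≥0∞)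
    (x : ℤ) : ℝ≥0∞ :=
  ∑' k, ξ k * stepMean (η k) f x

theorem sum_pmf_eq_one {α : Type*} [Fintype α] (p : PMF α) : ∑ a, p a = 1 := by
  rw [← p.tsum_coe, tsum_fintype]

theorem stepMean_le_one {k : ℕ} (p : PMF (Fin k → SignType)) {f : ℤ → ℝ≥0∞} (hf : ∀ x, f x ≤ 1)
    (x : ℤ) : stepMean p f x ≤ 1 :=
  calc stepMean p f x ≤ ∑ s, p s :=
        Finset.sum_le_sum fun _ _ => mul_le_of_le_one_right' (Finset.prod_le_one' fun _ _ => hf _)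
    _ = 1 := sum_pmf_eq_one p

theorem offspring_le_one (ξ : PMF ℕ) (η : (k : ℕ) → PMF (Fin k → SignType)) {f : ℤ → ℝ≥0∞}
    (hf : ∀ x, f x ≤ 1) (x : ℤ) : offspring ξ η f x ≤ 1 :=
  calc offspring ξ η f x ≤ ∑' k, ξ k :=
        ENNReal.tsum_le_tsum fun k => mul_le_of_le_one_right' (stepMean_le_one (η k) hf x)
    _ = 1 := ξ.tsum_coe

end Offspring

namespace LTree

/-- A labelled tree as a displacement vector together with the subtrees of the children. -/
def nodeEquiv (x : ℤ) :
    (Σ k : ℕ, Σ s : Fin k → SignType, (i : Fin k) → LTree (x + (s i : ℤ))) ≃ LTree x where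
  toFun p := node x p.1 p.2.1 p.2.2
  invFun | node _ k s c => ⟨k, s, c⟩
  left_inv _ := rfl
  right_inv | node _ _ _ _ => rfl

theorem tsum_eq_tsum_node {x : ℤ} (f : LTree x → ℝ≥0∞) :
    ∑' t, f t = ∑' k, ∑ s : Fin k → SignType, ∑' c, f (node x k s c) := by
  rw [← (nodeEquiv x).tsum_eq, ENNReal.tsum_sigma']
  refine tsum_congr fun k => ?_
  rw [ENNReal.tsum_sigma', tsum_fintype]
  rfl

variable (ξ : PMF ℕ) (η : (k : ℕ) → PMF (Fin k → SignType))

theorem tsum_eq_offspring {f g : {y : ℤ} → LTree y → ℝ≥0∞} {x : ℤ}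
    (h : ∀ k s c, f (node x k s c) = ξ k * η k s * ∏ i, g (c i)) :
    ∑' t : LTree x, f t = offspring ξ η (fun y => ∑' t : LTree y, g t) x := by
  rw [tsum_eq_tsum_node, offspring]
  refine tsum_congr fun k => ?_
  rw [stepMean, Finset.mul_sum]
  refine Finset.sum_congr rfl fun s _ => ?_
  simp_rw [h, ENNReal.tsum_mul_left, mul_assoc]
  rw [tsum_pi_prod fun i => g]

/-- The weight of a tree, set to zero unless its height is less than `d`. -/
noncomputable def weightBelow : ℕ → {x : ℤ} → LTree x → ℝ≥0∞
  | 0, _, _ => 0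
  | d + 1, _, node _ k s c => ξ k * η k s * ∏ i, weightBelow d (c i)

theorem eventually_weightBelow_eq {x : ℤ} (t : LTree x) :
    ∀ᶠ d in Filter.atTop, weightBelow ξ η d t = weight ξ η t := by
  induction t with
  | node x k s c ih =>
    rw [← Filter.eventually_all] at ih
    obtain ⟨d, hd⟩ := Filter.eventually_atTop.1 ih
    refine Filter.eventually_atTop.2 ⟨d + 1, fun e he => ?_⟩
    obtain ⟨e, rfl⟩ := Nat.exists_eq_add_of_le' (Nat.one_le_of_lt he)
    simp only [weightBelow, weight, hd e (by omega)]

theorem tsum_weightBelow_le_one (d : ℕ) (x : ℤ) : ∑' t : LTree x, weightBelow ξ η d t ≤ 1 := by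
  induction d generalizing x with
  | zero => simp [weightBelow]
  | succ d ih =>
    rw [tsum_eq_offspring ξ η (f := weightBelow ξ η (d + 1)) (g := weightBelow ξ η d)
      fun _ _ _ => rfl]
    exact offspring_le_one ξ η ih x

theorem tsum_weight_le_one (x : ℤ) : ∑' t : LTree x, weight ξ η t ≤ 1 := by
  refine ENNReal.summable.tsum_le_of_sum_le fun S => ?_
  have hS : ∀ᶠ d in Filter.atTop, ∀ t ∈ S, weightBelow ξ η d t = weight ξ η t :=
    (Filter.eventually_all_finset S).2 fun t _ => eventually_weightBelow_eq ξ η t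
  obtain ⟨d, hd⟩ := hS.exists
  calc ∑ t ∈ S, weight ξ η t = ∑ t ∈ S, weightBelow ξ η d t :=
        Finset.sum_congr rfl fun t ht => (hd t ht).symm
    _ ≤ ∑' t : LTree x, weightBelow ξ η d t := ENNReal.sum_le_tsum S
    _ ≤ 1 := tsum_weightBelow_le_one ξ η d x

/-- The probability that the tree rooted at `x` is finite. -/
noncomputable def mass (x : ℤ) : ℝ≥0∞ := ∑' t : LTree x, weight ξ η t

theorem mass_eq_offspring (x : ℤ) : mass ξ η x = offspring ξ η (mass ξ η) x :=
  tsum_eq_offspring ξ η (g := weight ξ η) fun _ _ _ => rfl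

theorem hits_node_self {l : ℤ} (k : ℕ) (s : Fin k → SignType)
    (c : (i : Fin k) → LTree (l + (s i : ℤ))) : hits l (node l k s c) = 1 := by
  simp [hits, trunc, leaves]

theorem hits_node_of_ne {x l : ℤ} (h : x ≠ l) (k : ℕ) (s : Fin k → SignType)
    (c : (i : Fin k) → LTree (x + (s i : ℤ))) : hits l (node x k s c) = ∑ i, hits l (c i) := by
  obtain rfl | hk := eq_or_ne k 0
  · simp [hits, trunc, leaves, h]
  · simp [hits, trunc, leaves, h, hk]

/-- The generating function, at `z`, of the number of first hitting points of level `l` in the tree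
rooted at `x`. -/
noncomputable def hitGen (l : ℤ) (z : ℝ≥0∞) (x : ℤ) : ℝ≥0∞ :=
  ∑' t : LTree x, weight ξ η t * z ^ hits l t

theorem hitGen_self (l : ℤ) (z : ℝ≥0∞) : hitGen ξ η l z l = mass ξ η l * z := by
  rw [hitGen, mass, ← ENNReal.tsum_mul_right]
  refine tsum_congr fun t => ?_
  obtain ⟨_, k, s, c⟩ := t
  rw [hits_node_self, pow_one]

theorem hitGen_eq_offspring {l x : ℤ} (h : x ≠ l) (z : ℝ≥0∞) :
    hitGen ξ η l z x = offspring ξ η (hitGen ξ η l z) x := by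
  refine tsum_eq_offspring ξ η (f := fun t => weight ξ η t * z ^ hits l t)
    (g := fun t => weight ξ η t * z ^ hits l t) fun k s c => ?_
  rw [hits_node_of_ne h, Finset.prod_mul_distrib, Finset.prod_pow_eq_pow_sum, weight, mul_assoc]

theorem hitGen_le_one (l : ℤ) {z : ℝ≥0∞} (hz : z ≤ 1) (x : ℤ) : hitGen ξ η l z x ≤ 1 :=
  (ENNReal.tsum_le_tsum fun _ => mul_le_of_le_one_right' (pow_le_one' hz _)).trans
    (tsum_weight_le_one ξ η x)

theorem tsum_hitLaw_mul_pow (l : ℤ) (z : ℝ≥0∞) :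
    ∑' n, hitLaw ξ η l n * z ^ n = hitGen ξ η l z 0 := by
  rw [hitGen, ← (Equiv.sigmaFiberEquiv (hits l (x := 0))).tsum_eq, ENNReal.tsum_sigma']
  refine tsum_congr fun n => ?_
  rw [hitLaw, ← ENNReal.tsum_mul_right]
  refine tsum_congr fun t => ?_
  simp only [Equiv.sigmaFiberEquiv_apply, t.2]

theorem tsum_hitLaw (l : ℤ) : ∑' n, hitLaw ξ η l n = mass ξ η 0 := by
  simpa [hitGen, mass] using tsum_hitLaw_mul_pow ξ η l 1

theorem hitLaw_le_one (l : ℤ) (n : ℕ) : hitLaw ξ η l n ≤ 1 :=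
  (ENNReal.le_tsum n).trans ((tsum_hitLaw ξ η l).trans_le (tsum_weight_le_one ξ η 0))

theorem genFun_hitLaw (l : ℤ) {z : ℝ} (hz : 0 ≤ z) :
    genFun (hitLaw ξ η l) z = (hitGen ξ η l (ENNReal.ofReal z) 0).toReal := by
  have hfin : ∀ n, hitLaw ξ η l n ≠ ∞ := fun n =>
    ((hitLaw_le_one ξ η l n).trans_lt ENNReal.one_lt_top).ne
  rw [← tsum_hitLaw_mul_pow, ENNReal.tsum_toReal_eq fun n =>
    ENNReal.mul_ne_top (hfin n) (ENNReal.pow_ne_top ENNReal.ofReal_ne_top)]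
  simp [genFun, hz]

end LTree

section Deficit

/-- The deficit `1 - f` of a `[0, 1]`-valued function, as a real number. -/
noncomputable def deficit (f : ℤ → ℝ≥0∞) (x : ℤ) : ℝ := 1 - (f x).toReal

/-- Where a `[0, 1]`-valued function is fixed by the offspring operator, the second difference of
its deficit is the given curvature. -/
def HasCurvature (ξ : PMF ℕ) (η : (k : ℕ) → PMF (Fin k → SignType)) (α β γ : ℝ) : Prop :=
  ∀ f : ℤ → ℝ≥0∞, (∀ x, f x ≤ 1) → ∀ x, f x = offspring ξ η f x →
    deficit f (x - 1) - 2 * deficit f x + deficit f (x + 1) =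
      curvature α β γ (deficit f (x - 1)) (deficit f x) (deficit f (x + 1))

theorem deficit_mem_Icc {f : ℤ → ℝ≥0∞} (hf : ∀ x, f x ≤ 1) (x : ℤ) :
    deficit f x ∈ Set.Icc (0 : ℝ) 1 :=
  ⟨sub_nonneg.2 (ENNReal.toReal_le_of_le_ofReal zero_le_one (by simpa using hf x)),
    sub_le_self _ ENNReal.toReal_nonneg⟩

variable {ξ : PMF ℕ} {η : (k : ℕ) → PMF (Fin k → SignType)} {α β γ θ κ : ℝ}

theorem HasCurvature.isSolution (hc : HasCurvature ξ η α β γ) {f : ℤ → ℝ≥0∞} (hf : ∀ x, f x ≤ 1)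
    {x ε : ℤ} (hε : IsUnit ε)
    (hfix : ∀ n : ℕ, f (x + ε * (n + 1)) = offspring ξ η f (x + ε * (n + 1))) :
    IsSolution α β γ fun n : ℕ => deficit f (x + ε * n) where
  mem_Icc n := deficit_mem_Icc hf _
  recursion n := by
    have hrec := hc f hf _ (hfix n)
    push_cast
    obtain rfl | rfl := Int.isUnit_iff.1 hε
    · convert hrec using 3 <;> ring_nf
    · rw [curvature_comm, sub_add_comm]
      convert hrec using 3 <;> ring_nf

theorem HasCurvature.mass_eq_one (hc : HasCurvature ξ η α β γ) (h : IsIntegrable α β γ θ κ)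
    (x : ℤ) : LTree.mass ξ η x = 1 := by
  set f := LTree.mass ξ η
  have hle : ∀ y, f y ≤ 1 := LTree.tsum_weight_le_one ξ η
  have hfix : ∀ y, f y = offspring ξ η f y := LTree.mass_eq_offspring ξ η
  have hanti : ∀ {ε : ℤ}, IsUnit ε → ∀ y, deficit f (y + ε) ≤ deficit f y := fun hε y => by
    simpa using h.antitone (hc.isSolution hle (x := y) hε fun _ => hfix _) zero_le_one
  have hnext : ∀ y, deficit f (y + 1) = deficit f y := fun y =>
    (hanti isUnit_one y).antisymm (by simpa using hanti isUnit_one.neg (y + 1))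
  have hprev : deficit f (x - 1) = deficit f x := by simpa using (hnext (x - 1)).symm
  have hzero : deficit f x = 0 := h.eq_zero_of_curvature_self <| by
    have hrec := hc f hle x (hfix x)
    rw [hnext, hprev] at hrec
    linarith
  exact (ENNReal.toReal_eq_one_iff _).1 (sub_eq_zero.1 hzero).symm

theorem HasCurvature.genFun_hitLaw (hc : HasCurvature ξ η α β γ) (h : IsIntegrable α β γ θ κ)
    {l : ℤ} (hl : IsUnit l) {z : ℝ} (h0 : 0 ≤ z) (h1 : z ≤ 1) :
    genFun (hitLaw ξ η l) z = 1 - energyRoot θ κ (1 - z) := by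
  set f := LTree.hitGen ξ η l (ENNReal.ofReal z)
  have hsol := hc.isSolution (LTree.hitGen_le_one ξ η l (ENNReal.ofReal_le_one.2 h1)) (x := l)
    hl.neg fun n => LTree.hitGen_eq_offspring ξ η (by
      obtain rfl | rfl := Int.isUnit_iff.1 hl <;> omega) _
  have hlevel : deficit f l = 1 - z := by
    simp [f, deficit, LTree.hitGen_self, hc.mass_eq_one h, h0]
  have hroot : deficit f 0 = energyRoot θ κ (1 - z) := by
    simpa [hlevel, f] using h.eq_energyRoot hsol
  rw [LTree.genFun_hitLaw ξ η l h0, ← hroot, deficit, sub_sub_cancel]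

theorem HasCurvature.genFun_nuPlus (hc : HasCurvature ξ η α β γ) (h : IsIntegrable α β γ θ κ)
    {z : ℝ} (h0 : 0 ≤ z) (h1 : z ≤ 1) :
    genFun (nuPlus ξ η) z = 1 - energyRoot θ κ (1 - z) :=
  hc.genFun_hitLaw h isUnit_one.neg h0 h1

theorem HasCurvature.genFun_nuPlus_zero (hc : HasCurvature ξ η α β γ)
    (h : IsIntegrable α β γ θ κ) : genFun (nuPlus ξ η) 0 = 1 - energyRoot θ κ 1 := by
  simpa using hc.genFun_nuPlus h le_rfl zero_le_one

theorem HasCurvature.tsum_nuPlus (hc : HasCurvature ξ η α β γ) (h : IsIntegrable α β γ θ κ) :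
    ∑' n, nuPlus ξ η n = 1 :=
  (LTree.tsum_hitLaw ξ η _).trans (hc.mass_eq_one h 0)

theorem HasCurvature.nuMinus_eq_nuPlus (hc : HasCurvature ξ η α β γ)
    (h : IsIntegrable α β γ θ κ) : nuMinus ξ η = nuPlus ξ η :=
  eq_of_genFun_eq (LTree.hitLaw_le_one ξ η 1) (LTree.hitLaw_le_one ξ η (-1)) fun _ h0 h1 =>
    (hc.genFun_hitLaw h isUnit_one h0.le h1.le).trans
      (hc.genFun_nuPlus h h0.le h1.le).symm

end Deficit

section OffspringLaws

theorem pmf_apply_of_unique {α : Type*} [Unique α] (p : PMF α) (a : α) : p a = 1 := by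
  rw [← p.tsum_coe, tsum_eq_single a fun b hb => (hb (Subsingleton.elim _ _)).elim]

theorem stepMean_zero (p : PMF (Fin 0 → SignType)) (f : ℤ → ℝ≥0∞) (x : ℤ) :
    stepMean p f x = 1 := by
  simp [stepMean, pmf_apply_of_unique]

theorem stepMean_pure {k : ℕ} (s : Fin k → SignType) (f : ℤ → ℝ≥0∞) (x : ℤ) :
    stepMean (PMF.pure s) f x = ∏ i, f (x + (s i : ℤ)) := by
  simp [stepMean, PMF.pure_apply]

theorem stepMean_uniformOfFinset {k : ℕ} {S : Finset (Fin k → SignType)} (hS : S.Nonempty)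
    (f : ℤ → ℝ≥0∞) (x : ℤ) :
    stepMean (PMF.uniformOfFinset S hS) f x =
      (S.card : ℝ≥0∞)⁻¹ * ∑ s ∈ S, ∏ i, f (x + (s i : ℤ)) := by
  simp [stepMean, PMF.uniformOfFinset_apply, Finset.mul_sum]

theorem stepMean_iidSteps (u : PMF SignType) (k : ℕ) (f : ℤ → ℝ≥0∞) (x : ℤ) :
    stepMean (iidSteps u k) f x = (∑ a, u a * f (x + (a : ℤ))) ^ k := by
  simp [stepMean, iidSteps, Fintype.sum_pow, Finset.prod_mul_distrib]

variable {η : (k : ℕ) → PMF (Fin k → SignType)}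

theorem offspring_critGeometric {u : PMF SignType} (hη : ∀ k, 1 ≤ k → η k = iidSteps u k)
    (f : ℤ → ℝ≥0∞) (x : ℤ) :
    offspring critGeometric η f x = (2 - ∑ a, u a * f (x + (a : ℤ)))⁻¹ := by
  set A := ∑ a, u a * f (x + (a : ℤ))
  have hpow : ∀ k, stepMean (η k) f x = A ^ k := fun k => by
    obtain rfl | hk := k.eq_zero_or_pos
    · rw [stepMean_zero, pow_zero]
    · rw [hη k hk, stepMean_iidSteps]
  calc offspring critGeometric η f x = ∑' k, 2⁻¹ * (2⁻¹ * A) ^ k :=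
        tsum_congr fun k => by rw [hpow, mul_pow, ← mul_assoc, ← pow_succ']; rfl
    _ = (2 * (1 - 2⁻¹ * A))⁻¹ := by
        rw [ENNReal.tsum_mul_left, ENNReal.tsum_geometric, ENNReal.mul_inv (by simp) (by simp)]
    _ = (2 - A)⁻¹ := by
        rw [ENNReal.mul_sub (by simp), mul_one,
          ENNReal.mul_inv_cancel_left two_ne_zero ENNReal.ofNat_ne_top]

theorem sum_mul_deficit (u : PMF SignType) {f : ℤ → ℝ≥0∞} (hf : ∀ x, f x ≤ 1) (x : ℤ) :
    ∑ a, (u a).toReal * deficit f (x + (a : ℤ)) = 1 - (∑ a, u a * f (x + (a : ℤ))).toReal := by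
  have hsum : ∑ a, (u a).toReal = 1 := by
    rw [← ENNReal.toReal_sum fun a _ => u.apply_ne_top a, sum_pmf_eq_one, ENNReal.toReal_one]
  rw [ENNReal.toReal_sum fun a _ => ENNReal.mul_ne_top (u.apply_ne_top a)
    ((hf _).trans_lt ENNReal.one_lt_top).ne, ← hsum, ← Finset.sum_sub_distrib]
  simp only [deficit, ENNReal.toReal_mul, mul_sub, mul_one]

theorem sum_mul_deficit_sub_deficit {u : PMF SignType} (hη : ∀ k, 1 ≤ k → η k = iidSteps u k)
    {f : ℤ → ℝ≥0∞} (hf : ∀ x, f x ≤ 1) {x : ℤ} (hfix : f x = offspring critGeometric η f x) :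
    ∑ a, (u a).toReal * deficit f (x + (a : ℤ)) - deficit f x =
      deficit f x * ∑ a, (u a).toReal * deficit f (x + (a : ℤ)) := by
  rw [sum_mul_deficit u hf, deficit, hfix, offspring_critGeometric hη]
  set A := ∑ a, u a * f (x + (a : ℤ))
  have hA : A ≤ 1 :=
    calc A ≤ ∑ a, u a := Finset.sum_le_sum fun a _ => mul_le_of_le_one_right' (hf _)
      _ = 1 := sum_pmf_eq_one u
  have hA' : A.toReal ≤ 1 := ENNReal.toReal_le_of_le_ofReal zero_le_one (by simpa using hA)
  have hne : 2 - A.toReal ≠ 0 := by linarith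
  rw [ENNReal.toReal_inv, ENNReal.toReal_sub_of_le (hA.trans one_le_two) ENNReal.ofNat_ne_top,
    ENNReal.toReal_ofNat]
  field_simp
  ring

theorem sum_toReal_uniformOfFinset_mul {α : Type*} [Fintype α] {S : Finset α} (hS : S.Nonempty)
    (g : α → ℝ) :
    ∑ a, (PMF.uniformOfFinset S hS a).toReal * g a = (S.card : ℝ)⁻¹ * ∑ a ∈ S, g a := by
  rw [Finset.mul_sum, ← Finset.sum_subset S.subset_univ fun a _ ha => by
    rw [PMF.uniformOfFinset_apply_of_notMem hS ha, ENNReal.toReal_zero, zero_mul]]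
  refine Finset.sum_congr rfl fun a ha => ?_
  rw [PMF.uniformOfFinset_apply_of_mem hS ha, ENNReal.toReal_inv, ENNReal.toReal_natCast]

theorem hasCurvature_critGeometric_neg_pos
    (hη : ∀ k, 1 ≤ k → η k = iidSteps (PMF.uniformOfFinset {-1, 1} (by simp)) k) :
    HasCurvature critGeometric η 1 0 0 := by
  intro f hf x hfix
  have hsum : ∑ a ∈ ({-1, 1} : Finset SignType), deficit f (x + (a : ℤ)) =
      deficit f (x - 1) + deficit f (x + 1) := by
    simp [← sub_eq_add_neg]
  have hcard : Finset.card ({-1, 1} : Finset SignType) = 2 := rfl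
  have h := sum_mul_deficit_sub_deficit hη hf hfix
  rw [sum_toReal_uniformOfFinset_mul _ fun a : SignType => deficit f (x + (a : ℤ)), hsum, hcard,
    Nat.cast_ofNat] at h
  rw [curvature]
  linear_combination 2 * h

theorem hasCurvature_critGeometric_uniform
    (hη : ∀ k, 1 ≤ k → η k = iidSteps (PMF.uniformOfFinset {-1, 0, 1} (by simp)) k) :
    HasCurvature critGeometric η 1 1 0 := by
  intro f hf x hfix
  have hsum : ∑ a ∈ ({-1, 0, 1} : Finset SignType), deficit f (x + (a : ℤ)) =
      deficit f (x - 1) + (deficit f x + deficit f (x + 1)) := by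
    simp [← sub_eq_add_neg]
  have hcard : Finset.card ({-1, 0, 1} : Finset SignType) = 3 := rfl
  have h := sum_mul_deficit_sub_deficit hη hf hfix
  rw [sum_toReal_uniformOfFinset_mul _ fun a : SignType => deficit f (x + (a : ℤ)), hsum, hcard,
    Nat.cast_ofNat] at h
  rw [curvature]
  linear_combination 3 * h

theorem offspring_incompleteBinary (h1 : η 1 = PMF.uniformOfFinset {![-1], ![1]} (by simp))
    (h2 : η 2 = PMF.pure ![-1, 1]) (f : ℤ → ℝ≥0∞) (x : ℤ) :
    offspring incompleteBinary η f x =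
      4⁻¹ + (2⁻¹ * (2⁻¹ * (f (x - 1) + f (x + 1))) + 4⁻¹ * (f (x - 1) * f (x + 1))) := by
  have hne : (![-1] : Fin 1 → SignType) ≠ ![1] := by decide
  have hcard : Finset.card ({![-1], ![1]} : Finset (Fin 1 → SignType)) = 2 := rfl
  rw [offspring, tsum_eq_sum (s := {0, 1, 2}) fun k hk => by
    rw [incompleteBinary, PMF.ofFinset_apply_of_notMem _ _ hk, zero_mul]]
  simp [stepMean_zero, h1, h2, stepMean_pure, stepMean_uniformOfFinset, hcard,
    Finset.sum_pair hne, incompleteBinary, ← sub_eq_add_neg]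

theorem hasCurvature_incompleteBinary (h1 : η 1 = PMF.uniformOfFinset {![-1], ![1]} (by simp))
    (h2 : η 2 = PMF.pure ![-1, 1]) : HasCurvature incompleteBinary η 0 0 2⁻¹ := by
  intro f hf x hfix
  have hfin : ∀ y, f y ≠ ∞ := fun y => ((hf y).trans_lt ENNReal.one_lt_top).ne
  have h := congrArg ENNReal.toReal (hfix.trans (offspring_incompleteBinary h1 h2 f x))
  have := hfin (x - 1)
  have := hfin (x + 1)
  rw [ENNReal.toReal_add (by finiteness) (by finiteness),
    ENNReal.toReal_add (by finiteness) (by finiteness)] at h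
  simp only [ENNReal.toReal_mul, ENNReal.toReal_inv, ENNReal.toReal_ofNat,
    ENNReal.toReal_add (hfin (x - 1)) (hfin (x + 1))] at h
  simp only [deficit, curvature]
  linear_combination 2 * h

theorem offspring_completeBinary (h2 : η 2 = PMF.pure ![-1, 1]) (f : ℤ → ℝ≥0∞) (x : ℤ) :
    offspring completeBinary η f x = 2⁻¹ + 2⁻¹ * (f (x - 1) * f (x + 1)) := by
  have hcard : Finset.card ({0, 2} : Finset ℕ) = 2 := rfl
  rw [offspring, tsum_eq_sum (s := {0, 2}) fun k hk => by
    rw [completeBinary, PMF.uniformOfFinset_apply_of_notMem _ hk, zero_mul]]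
  simp [stepMean_zero, h2, stepMean_pure, hcard, completeBinary, PMF.uniformOfFinset_apply,
    ← sub_eq_add_neg]

theorem hasCurvature_completeBinary (h2 : η 2 = PMF.pure ![-1, 1]) :
    HasCurvature completeBinary η 0 0 1 := by
  intro f hf x hfix
  have hfin : ∀ y, f y ≠ ∞ := fun y => ((hf y).trans_lt ENNReal.one_lt_top).ne
  have h := congrArg ENNReal.toReal (hfix.trans (offspring_completeBinary h2 f x))
  have := hfin (x - 1)
  have := hfin (x + 1)
  rw [ENNReal.toReal_add (by finiteness) (by finiteness)] at h
  simp only [ENNReal.toReal_mul, ENNReal.toReal_inv, ENNReal.toReal_ofNat] at h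
  simp only [deficit, curvature]
  linear_combination 2 * h

end OffspringLaws

section RootFormulas

theorem rpow_three_halves {p : ℝ} (hp : 0 ≤ p) : p ^ (3 / 2 : ℝ) = p * √p := by
  rw [show (3 / 2 : ℝ) = 1 + 1 / 2 by norm_num, Real.rpow_add_of_nonneg hp zero_le_one
    (by norm_num), Real.rpow_one, Real.sqrt_eq_rpow]

theorem energyRoot_eq_div {θ κ p k d : ℝ} (hθ : 0 ≤ θ) (hp : 0 ≤ p) (hk : 0 ≤ k) (hd : 0 ≤ d)
    (hkd : (θ ^ 2 + 12 * κ) * p + 24 * θ = k ^ 2 * d) (hne : 3 - θ * p - κ * p ^ 2 ≠ 0) :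
    energyRoot θ κ p = (θ * p ^ 2 + 6 * p - k * √d * p ^ (3 / 2 : ℝ)) /
      (2 * (3 - θ * p - κ * p ^ 2)) := by
  have hsqrt : √(p * ((θ ^ 2 + 12 * κ) * p + 24 * θ)) = k * √d * √p := by
    rw [hkd, Real.sqrt_mul hp, Real.sqrt_mul (sq_nonneg k), Real.sqrt_sq hk, mul_comm]
  rw [energyRoot, hsqrt, rpow_three_halves hp,
    div_eq_div_iff (by positivity) (mul_ne_zero two_ne_zero hne)]
  linear_combination p *
    (√p ^ 2 * k ^ 2 * Real.sq_sqrt hd + k ^ 2 * d * Real.sq_sqrt hp - p * hkd)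

theorem one_sub_energyRoot_two_one {z : ℝ} (h0 : 0 < z) (h1 : z ≤ 1) :
    1 - energyRoot 2 1 (1 - z) =
      (-2 * z ^ 2 + 9 * z - 4 + 2 * √(4 - z) * (1 - z) ^ (3 / 2 : ℝ)) / (z * (4 - z)) := by
  have h4 : 0 < 4 - z := by linarith
  have hden : 3 - 2 * (1 - z) - 1 * (1 - z) ^ 2 = z * (4 - z) := by ring
  rw [energyRoot_eq_div (k := 4) (d := 4 - z) zero_le_two (sub_nonneg.2 h1) zero_le_four h4.le
    (by ring) (by rw [hden]; positivity), hden]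
  field_simp
  ring

theorem one_sub_energyRoot_three_zero {z : ℝ} (h0 : 0 < z) (h1 : z ≤ 1) :
    1 - energyRoot 3 0 (1 - z) =
      (-z ^ 2 + 6 * z - 3 + √(9 - z) * (1 - z) ^ (3 / 2 : ℝ)) / (2 * z) := by
  have hden : 3 - 3 * (1 - z) - 0 * (1 - z) ^ 2 = 3 * z := by ring
  rw [energyRoot_eq_div (k := 3) (d := 9 - z) zero_le_three (sub_nonneg.2 h1) zero_le_three
    (by linarith) (by ring) (by rw [hden]; positivity), hden]
  field_simp
  ring

theorem one_sub_energyRoot_half_zero {z : ℝ} (h0 : 0 ≤ z) (h1 : z ≤ 1) :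
    1 - energyRoot 2⁻¹ 0 (1 - z) =
      (-z ^ 2 + 16 * z - 3 + √(49 - z) * (1 - z) ^ (3 / 2 : ℝ)) / (2 * (z + 5)) := by
  have hden : 3 - 2⁻¹ * (1 - z) - 0 * (1 - z) ^ 2 = (z + 5) / 2 := by ring
  rw [energyRoot_eq_div (k := 2⁻¹) (d := 49 - z) (by norm_num) (sub_nonneg.2 h1) (by norm_num)
    (by linarith) (by ring) (by rw [hden]; positivity), hden]
  field_simp
  ring

theorem one_sub_energyRoot_one_zero {z : ℝ} (h0 : 0 ≤ z) (h1 : z ≤ 1) :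
    1 - energyRoot 1 0 (1 - z) =
      (-z ^ 2 + 10 * z - 3 + √(25 - z) * (1 - z) ^ (3 / 2 : ℝ)) / (2 * (z + 2)) := by
  have hden : 3 - 1 * (1 - z) - 0 * (1 - z) ^ 2 = z + 2 := by ring
  rw [energyRoot_eq_div (k := 1) (d := 25 - z) zero_le_one (sub_nonneg.2 h1) zero_le_one
    (by linarith) (by ring) (by rw [hden]; positivity), hden]
  field_simp
  ring

theorem one_sub_energyRoot_two_one_one : 1 - energyRoot 2 1 1 = 5 / 8 := by
  have h : √(64 : ℝ) = 8 := by rw [Real.sqrt_eq_iff_mul_self_eq] <;> norm_num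
  norm_num [energyRoot, h]

theorem one_sub_energyRoot_three_zero_one : 1 - energyRoot 3 0 1 = 2 / 3 := by
  have h : √(81 : ℝ) = 9 := by rw [Real.sqrt_eq_iff_mul_self_eq] <;> norm_num
  norm_num [energyRoot, h]

end RootFormulas

theorem proposition3p4 :
    -- critical geometric offspring, i.i.d. uniform displacements in {-1, 1}
    (∀ η : (k : ℕ) → PMF (Fin k → SignType),
      (∀ k, 1 ≤ k → η k = iidSteps (PMF.uniformOfFinset {-1, 1} (by simp)) k) →
      (∑' n, nuPlus critGeometric η n) = 1 ∧ nuMinus critGeometric η = nuPlus critGeometric η ∧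
      (∀ z : ℝ, 0 < z → z ≤ 1 → genFun (nuPlus critGeometric η) z =
        (-2 * z ^ 2 + 9 * z - 4 + 2 * √(4 - z) * (1 - z) ^ (3 / 2 : ℝ)) / (z * (4 - z))) ∧
      -- the value at 0, where the right-hand side is understood as its limit
      genFun (nuPlus critGeometric η) 0 = 5 / 8 ∧
      Filter.Tendsto (fun z : ℝ =>
        (-2 * z ^ 2 + 9 * z - 4 + 2 * √(4 - z) * (1 - z) ^ (3 / 2 : ℝ)) / (z * (4 - z)))
        (𝓝[>] 0) (𝓝 (genFun (nuPlus critGeometric η) 0))) ∧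
    -- critical geometric offspring, i.i.d. uniform displacements in {-1, 0, 1}
    (∀ η : (k : ℕ) → PMF (Fin k → SignType),
      (∀ k, 1 ≤ k → η k = iidSteps (PMF.uniformOfFinset {-1, 0, 1} (by simp)) k) →
      (∑' n, nuPlus critGeometric η n) = 1 ∧ nuMinus critGeometric η = nuPlus critGeometric η ∧
      (∀ z : ℝ, 0 < z → z ≤ 1 → genFun (nuPlus critGeometric η) z =
        (-z ^ 2 + 6 * z - 3 + √(9 - z) * (1 - z) ^ (3 / 2 : ℝ)) / (2 * z)) ∧
      genFun (nuPlus critGeometric η) 0 = 2 / 3 ∧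
      Filter.Tendsto (fun z : ℝ =>
        (-z ^ 2 + 6 * z - 3 + √(9 - z) * (1 - z) ^ (3 / 2 : ℝ)) / (2 * z))
        (𝓝[>] 0) (𝓝 (genFun (nuPlus critGeometric η) 0))) ∧
    -- incomplete binary trees with natural embedding
    (∀ η : (k : ℕ) → PMF (Fin k → SignType),
      η 1 = PMF.uniformOfFinset {![-1], ![1]} (by simp) →
      η 2 = PMF.pure ![-1, 1] →
      (∑' n, nuPlus incompleteBinary η n) = 1 ∧
      nuMinus incompleteBinary η = nuPlus incompleteBinary η ∧
      ∀ z : ℝ, 0 ≤ z → z ≤ 1 → genFun (nuPlus incompleteBinary η) z =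
        (-z ^ 2 + 16 * z - 3 + √(49 - z) * (1 - z) ^ (3 / 2 : ℝ)) / (2 * (z + 5))) ∧
    -- complete binary trees with natural embedding
    (∀ η : (k : ℕ) → PMF (Fin k → SignType),
      η 2 = PMF.pure ![-1, 1] →
      (∑' n, nuPlus completeBinary η n) = 1 ∧
      nuMinus completeBinary η = nuPlus completeBinary η ∧
      ∀ z : ℝ, 0 ≤ z → z ≤ 1 → genFun (nuPlus completeBinary η) z =
        (-z ^ 2 + 10 * z - 3 + √(25 - z) * (1 - z) ^ (3 / 2 : ℝ)) / (2 * (z + 2))) := by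
  have hadj := isIntegrable_adjacent
  have hall := isIntegrable_adjacent_add_center
  have hhalf := isIntegrable_outer (inv_pos.2 two_pos) (inv_le_one_of_one_le₀ one_le_two)
  have hone := isIntegrable_outer one_pos le_rfl
  refine ⟨fun η hη => ?_, fun η hη => ?_, fun η h₁ h₂ => ?_, fun η h₂ => ?_⟩
  · have hc := hasCurvature_critGeometric_neg_pos hη
    have hgen := fun z h0 h1 => (hc.genFun_nuPlus hadj (z := z) h0.le h1).trans
      (one_sub_energyRoot_two_one h0 h1)
    exact ⟨hc.tsum_nuPlus hadj, hc.nuMinus_eq_nuPlus hadj, hgen,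
      (hc.genFun_nuPlus_zero hadj).trans one_sub_energyRoot_two_one_one,
      tendsto_of_genFun_eq (LTree.hitLaw_le_one _ _ _) hgen⟩
  · have hc := hasCurvature_critGeometric_uniform hη
    have hgen := fun z h0 h1 => (hc.genFun_nuPlus hall (z := z) h0.le h1).trans
      (one_sub_energyRoot_three_zero h0 h1)
    exact ⟨hc.tsum_nuPlus hall, hc.nuMinus_eq_nuPlus hall, hgen,
      (hc.genFun_nuPlus_zero hall).trans one_sub_energyRoot_three_zero_one,
      tendsto_of_genFun_eq (LTree.hitLaw_le_one _ _ _) hgen⟩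
  · have hc := hasCurvature_incompleteBinary h₁ h₂
    exact ⟨hc.tsum_nuPlus hhalf, hc.nuMinus_eq_nuPlus hhalf, fun z h0 h1 =>
      (hc.genFun_nuPlus hhalf h0 h1).trans (one_sub_energyRoot_half_zero h0 h1)⟩
  · have hc := hasCurvature_completeBinary h₂
    exact ⟨hc.tsum_nuPlus hone, hc.nuMinus_eq_nuPlus hone, fun z h0 h1 =>
      (hc.genFun_nuPlus hone h0 h1).trans (one_sub_energyRoot_one_zero h0 h1)⟩
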